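/- Let $X$ and $Z$ be real Hausdorff locally convex topological vector spaces, and let $C\subseteq Z$ be a convex pointed cone, that is, $tc\in C$ for all $c\in C$, $t\ge 0$, $C+C=C$ and $C\cap(-C)=\{0\}$ (the interior of $C$ may be empty). Let $K\subseteq X$ be nonempty, convex and compact, and let $D\subseteq K$ be self-segment-dense in $K$: $D$ is dense in $K$, and for all $x,y\in D$ the set $[x,y]\cap D$ is dense in the segment $[x,y]$. A map $g:K\to Z$ is called strongly $C$-upper semicontinuous at $x\in K$ if for every $k\in C\setminus\{0\}$ there is a neighbourhood $U$ of $x$ such that $g(u)\in g(x)+k-(C\setminus\{0\})$ for all $u\in U\cap K$. It is called $C$-convex on $D$ if for all $n\in\mathbb N$, $x_1,\dots,x_n\in D$ and $\lambda_1,\dots,\lambda_n\ge 0$ with $\sum_{i=1}^n\lambda_i=1$ and $\sum_{i=1}^n\lambda_i x_i\in D$, one has $\sum_{i=1}^n\lambda_i g(x_i)-g\bigl(\sum_{i=1}^n\lambda_i x_i\bigr)\in C$. Let $f:K\times K\to Z$ satisfy: (i) for every $y\in D$, the map $x\mapsto f(x,y)$ is strongly $C$-upper semicontinuous at every point of $K$;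 (ii) for every $x\in K$, the map $y\mapsto f(x,y)$, defined on $K$, is strongly $C$-upper semicontinuous at every point of $K\setminus D$; (iii) for every $x\in D$, the map $y\mapsto f(x,y)$ is $C$-convex on $D$; (iv) for every $x\in D$, $f(x,x)\notin -(C\setminus\{0\})$. Then there exists $x_0\in K$ such that $f(x_0,y)\notin -(C\setminus\{0\})$ for all $y\in K$. -/

import Mathlib

open scoped Topology Pointwise

/-- For `V` convex: `U ⊆ V` is self-segment-dense in `V` if `U` is dense in `V` and, for all
`x, y ∈ U`, the set `[x, y] ∩ U` is dense in the closed segment `[x, y]`. -/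
structure IsSelfSegmentDense {X : Type*} [AddCommGroup X] [Module ℝ X] [TopologicalSpace X]
    (U V : Set X) : Prop where
  subset : U ⊆ V
  dense : V ⊆ closure U
  segment_dense : ∀ x ∈ U, ∀ y ∈ U, segment ℝ x y ⊆ closure (segment ℝ x y ∩ U)

/-- The map `g : K → Z` (given by its values on `K`) is strongly `C`-upper semicontinuous at `x`:
for each `k ∈ C \ {0}` there is a neighbourhood `U` of `x` such that
`g u ∈ g x + k - (C \ {0})` for all `u ∈ U ∩ K`. -/
def StronglyCUpperSemicontinuousAt {X Z : Type*} [TopologicalSpace X] [AddCommGroup Z]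
    (C : Set Z) (K : Set X) (g : X → Z) (x : X) : Prop :=
  ∀ k ∈ C \ {0}, ∃ U ∈ 𝓝 x, ∀ u ∈ U ∩ K, g u ∈ {g x + k} - (C \ {0})

/-- The map `g` is `C`-convex on the (not necessarily convex) set `S`: whenever a convex
combination of points of `S` lies in `S`, one has `g (∑ λᵢ xᵢ) ≤ ∑ λᵢ g (xᵢ)` in the order
`z₁ ≤ z₂ ↔ z₂ - z₁ ∈ C`. -/
def CConvexOn {X Z : Type*} [AddCommGroup X] [Module ℝ X] [AddCommGroup Z] [Module ℝ Z]
    (C : Set Z) (S : Set X) (g : X → Z) : Prop :=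
  ∀ (n : ℕ) (x : Fin n → X) (w : Fin n → ℝ), (∀ i, x i ∈ S) → (∀ i, 0 ≤ w i) →
    ∑ i, w i = 1 → ∑ i, w i • x i ∈ S →
      (∑ i, w i • g (x i)) - g (∑ i, w i • x i) ∈ C

/-! For `y ∈ D` let `G y` be the set of `x ∈ K` with `f x y ∉ -(C \ {0})`. By (i) it is closed. If
`z ∈ D` is a convex combination of points of `D` and lay in none of their sets `G`, then (iii) would
force `f z z ∈ -(C \ {0})`, against (iv). So these sets cover the points of `D` in each polytope
with vertices in `D`. Such points are dense in the polytope
(`IsSelfSegmentDense.convexHull_subset_closure`), and a finite union of closed sets is closed, so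
the whole polytope is covered. The KKM lemma `exists_mem_forall_of_convexHull_subset` and
compactness of `K` then give `x₀` in all `G y`, `y ∈ D`. A bad `y ∈ K \ D` would by (ii) have bad
neighbours in the dense set `D`.

KKM is deduced from Brouwer's theorem on the simplex, and Brouwer's from Scarf's lemma, a parity
argument on finite sets with several rankings. -/

/-! ### Scarf's combinatorial lemma -/

section Scarf

variable {I V α : Type*} [LinearOrder α]

/-- A finite set `S` is dominant for the family of rankings `r` if every element of `V` is, for
some ranking, weakly below all elements of `S`. -/
def IsDominant (r : I → V → α) (S : Finset V) : Prop :=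
  ∀ y, ∃ i, ∀ x ∈ S, r i y ≤ r i x

theorem IsDominant.mono {r : I → V → α} {S T : Finset V} (hT : IsDominant r T) (h : S ⊆ T) :
    IsDominant r S := fun y => (hT y).imp fun _ hi x hx => hi x (h hx)

variable [DecidableEq V]

/-- Ranking `a` can be spared, since the others already exhibit each element of `S` as a minimum.
The new element is the `r a`-highest among those lying above the minima of `S` in all rankings but
`a`. -/
theorem IsDominant.existsUnique_insert [Finite V] {r : I → V → α}
    (hr : ∀ i, Function.Injective (r i)) {S : Finset V} (hS : IsDominant r S) {m : I → V}
    (hmS : ∀ i, m i ∈ S) (hm : ∀ i, ∀ x ∈ S, r i (m i) ≤ r i x) {a : I}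
    (hsurj : ∀ x ∈ S, ∃ i, i ≠ a ∧ m i = x) {v : V} (hv : ∀ i, i ≠ a → r i (m i) < r i v) :
    ∃! x, x ∉ S ∧ IsDominant r (insert x S) ∧ ∀ i, i ≠ a → r i (m i) < r i x := by
  obtain ⟨x, hxM, hmax⟩ := Set.exists_max_image {x | ∀ i, i ≠ a → r i (m i) < r i x} (r a)
    (Set.toFinite _) ⟨v, hv⟩
  refine ⟨x, ⟨fun hx => ?_, fun y => ?_, hxM⟩, ?_⟩
  · obtain ⟨i, hia, rfl⟩ := hsurj x hx
    exact lt_irrefl _ (hxM i hia)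
  · by_contra! hcon
    have hyM : ∀ i, i ≠ a → r i (m i) < r i y := by
      intro i hia
      obtain ⟨z, hz, hlt⟩ := hcon i
      rcases Finset.mem_insert.1 hz with rfl | hz
      · exact (hxM i hia).trans hlt
      · exact (hm i z hz).trans_lt hlt
    obtain ⟨z, hz, hlt⟩ := hcon a
    rcases Finset.mem_insert.1 hz with rfl | hz
    · exact absurd (hmax y hyM) (not_le.2 hlt)
    · obtain ⟨i, hi⟩ := hS y
      have hi' := hi _ (hmS i)
      by_cases hia : i = a
      · subst hia
        exact absurd hi' (not_le.2 ((hm i z hz).trans_lt hlt))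
      · exact absurd hi' (not_le.2 (hyM i hia))
  · rintro y ⟨-, hy, hyM⟩
    obtain ⟨i, hi⟩ := hy x
    have hia : i = a := by
      by_contra hia
      exact absurd (hi _ (Finset.mem_insert_of_mem (hmS i))) (not_le.2 (hxM i hia))
    subst hia
    exact hr i (le_antisymm (hmax y hyM) (hi y (Finset.mem_insert_self _ _)))

variable [Fintype I] [DecidableEq I]

open Classical in
/-- A set with one element less than there are rankings, not consisting of slack elements only,
has an even number of one-point extensions which are dominant. -/
theorem even_card_dominant_insert [Fintype V] {r : I → V → α} (hr : ∀ i, Function.Injective (r i))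
    {e : I → V} (hhigh : ∀ i j, i ≠ j → ∀ v, v ∉ Set.range e → r i v ≤ r i (e j))
    {S : Finset V} (hcard : S.card + 1 = Fintype.card I) {t : V} (htS : t ∈ S)
    (ht : t ∉ Set.range e) :
    Even (Finset.univ.filter fun x => x ∉ S ∧ IsDominant r (insert x S)).card := by
  by_cases hS : IsDominant r S
  swap
  · rw [Finset.filter_false_of_mem]
    · simp
    · rintro x - ⟨-, hx⟩
      exact hS (hx.mono (Finset.subset_insert _ _))
  have hex : ∀ i, ∃ x ∈ S, ∀ y ∈ S, r i x ≤ r i y := fun i => S.exists_min_image (r i) ⟨t, htS⟩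
  choose m hmS hm using hex
  have heq : ∀ i x, x ∈ S → (∀ y ∈ S, r i x ≤ r i y) → m i = x := fun i x hx h =>
    hr i (le_antisymm (hm i x hx) (h _ (hmS i)))
  have hsurj : ∀ x ∈ S, ∃ i, m i = x := fun x hx =>
    (hS x).imp fun i hi => heq i x hx hi
  -- There is one ranking more than elements of `S`, so exactly one pair of rankings shares its
  -- minimum. An added element must take over `a` or `b`, which yields one extension for each.
  obtain ⟨a, -, b, -, hab, hmab⟩ := Finset.exists_ne_map_eq_of_card_lt_of_maps_to
    (s := (Finset.univ : Finset I)) (t := S) (f := m)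
    (by rw [Finset.card_univ]; omega) (fun i _ => hmS i)
  have hsurja : ∀ x ∈ S, ∃ i, i ≠ a ∧ m i = x := by
    intro x hx
    obtain ⟨i, rfl⟩ := hsurj x hx
    by_cases hia : i = a
    · exact ⟨b, hab.symm, by rw [hia, hmab]⟩
    · exact ⟨i, hia, rfl⟩
  have hsurjb : ∀ x ∈ S, ∃ i, i ≠ b ∧ m i = x := by
    intro x hx
    obtain ⟨i, rfl⟩ := hsurj x hx
    by_cases hib : i = b
    · exact ⟨a, hab, by rw [hib, hmab]⟩
    · exact ⟨i, hib, rfl⟩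
  have hinj : ∀ c, (∀ x ∈ S, ∃ i, i ≠ c ∧ m i = x) →
      ∀ i j, i ≠ c → j ≠ c → m i = m j → i = j := by
    intro c hc i j hi hj hij
    have himg : (Finset.univ.erase c).image m = S := by
      ext x
      simp only [Finset.mem_image, Finset.mem_erase, Finset.mem_univ, and_true]
      exact ⟨fun ⟨i, _, h⟩ => h ▸ hmS i, hc x⟩
    have hinjOn : Set.InjOn m (Finset.univ.erase c : Finset I) := by
      rw [← Finset.card_image_iff, himg, Finset.card_erase_of_mem (Finset.mem_univ _),
        Finset.card_univ]
      omega
    exact hinjOn (by simpa using hi) (by simpa using hj) hij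
  have hv : ∀ c i, i ≠ c → r i (m i) < r i (e c) := fun c i hic =>
    (hm i t htS).trans_lt ((hhigh i c hic t ht).lt_of_ne fun h => ht ⟨c, (hr i h).symm⟩)
  obtain ⟨xa, ⟨hxaS, hxad, hxaM⟩, hxau⟩ := hS.existsUnique_insert hr hmS hm hsurja (hv a)
  obtain ⟨xb, ⟨hxbS, hxbd, hxbM⟩, hxbu⟩ := hS.existsUnique_insert hr hmS hm hsurjb (hv b)
  -- A common value would exceed the minimum of `S` in every ranking, against dominance of `S`.
  have hne : xa ≠ xb := by
    rintro rfl
    obtain ⟨i, hi⟩ := hS xa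
    by_cases hia : i = a
    · exact absurd (hi _ (hmS i)) (not_le.2 (hxbM i (hia ▸ hab)))
    · exact absurd (hi _ (hmS i)) (not_le.2 (hxaM i hia))
  have hfilter : (Finset.univ.filter fun x => x ∉ S ∧ IsDominant r (insert x S)) = {xa, xb} := by
    ext x
    simp only [Finset.mem_filter, Finset.mem_univ, true_and, Finset.mem_insert,
      Finset.mem_singleton]
    constructor
    · rintro ⟨hxS, hx⟩
      have key : ∀ y ∈ S, ∃ j, m j = y ∧ r j (m j) < r j x := by
        intro y hy
        obtain ⟨j, hj⟩ := hx y
        have hmj : m j = y := heq j y hy fun z hz => hj z (Finset.mem_insert_of_mem hz)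
        refine ⟨j, hmj, ?_⟩
        rw [hmj]
        exact (hj x (Finset.mem_insert_self _ _)).lt_of_ne fun h => hxS (hr j h ▸ hy)
      have hother : ∀ i, i ≠ a → i ≠ b → r i (m i) < r i x := by
        intro i hia hib
        obtain ⟨j, hj, hlt⟩ := key (m i) (hmS i)
        have hji : j = i := by
          by_cases hja : j = a
          · subst hja
            exact hinj b hsurjb j i hab hib hj
          · exact hinj a hsurja j i hja hia hj
        rwa [hji] at hlt
      obtain ⟨j, hj, hlt⟩ := key (m a) (hmS a)
      by_cases hja : j = a
      · subst hja
        right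
        refine hxbu x ⟨hxS, hx, fun i hib => ?_⟩
        by_cases hia : i = j
        · rwa [hia]
        · exact hother i hia hib
      · have hjb : j = b := hinj a hsurja j b hja hab.symm (hj.trans hmab)
        subst hjb
        left
        refine hxau x ⟨hxS, hx, fun i hia => ?_⟩
        by_cases hib : i = j
        · rwa [hib]
        · exact hother i hia hib
    · rintro (rfl | rfl)
      exacts [⟨hxaS, hxad⟩, ⟨hxbS, hxbd⟩]
  rw [hfilter, Finset.card_pair hne]
  exact even_two

open Classical in
/-- The set of all slack elements but one has exactly one dominant one-point extension. -/
theorem card_dominant_insert_slack [Fintype V] {r : I → V → α} (hr : ∀ i, Function.Injective (r i))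
    {e : I → V} (hlow : ∀ i v, r i (e i) ≤ r i v)
    (hhigh : ∀ i j, i ≠ j → ∀ v, v ∉ Set.range e → r i v ≤ r i (e j))
    {t : V} (ht : t ∉ Set.range e) (i₀ : I) {S : Finset V}
    (hS : S = (Finset.univ.erase i₀).image e) :
    (Finset.univ.filter fun x => x ∉ S ∧ IsDominant r (insert x S)).card = 1 := by
  have hmemS : ∀ j, j ≠ i₀ → e j ∈ S := fun j hj => by
    rw [hS]; exact Finset.mem_image_of_mem _ (by simpa using hj)
  have hnot : ∀ i v, v ∉ Set.range e → ¬ r i v ≤ r i (e i) := fun i v hv h =>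
    hv ⟨i, (hr i (le_antisymm h (hlow i v))).symm⟩
  -- Only ranking `i₀` lacks its slack element, so the extension must be the `r i₀`-highest
  -- non-slack element.
  obtain ⟨x, hx, hmax⟩ := Set.exists_max_image {x | x ∉ Set.range e} (r i₀)
    (Set.toFinite _) ⟨t, ht⟩
  rw [Finset.card_eq_one]
  refine ⟨x, ?_⟩
  ext y
  simp only [Finset.mem_filter, Finset.mem_univ, true_and, Finset.mem_singleton]
  constructor
  · rintro ⟨hyS, hy⟩
    have hidx : ∀ v, v ∉ Set.range e → ∀ i, (∀ z ∈ insert y S, r i v ≤ r i z) → i = i₀ := by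
      intro v hv i hi
      by_contra hne
      exact hnot i v hv (hi _ (Finset.mem_insert_of_mem (hmemS i hne)))
    have hye : y ∉ Set.range e := by
      rintro ⟨j, rfl⟩
      have hj : j = i₀ := by
        by_contra hne
        exact hyS (hmemS j hne)
      subst hj
      obtain ⟨i, hi⟩ := hy t
      obtain rfl := hidx t ht i hi
      exact hnot i t ht (hi _ (Finset.mem_insert_self _ _))
    obtain ⟨i, hi⟩ := hy x
    obtain rfl := hidx x hx i hi
    exact hr i (le_antisymm (hmax y hye) (hi _ (Finset.mem_insert_self _ _)))
  · rintro rfl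
    refine ⟨fun hyS => hx ?_, fun v => ?_⟩
    · rw [hS, Finset.mem_image] at hyS
      obtain ⟨j, -, hj⟩ := hyS
      exact ⟨j, hj⟩
    · by_cases hv : v ∈ Set.range e
      · obtain ⟨j, rfl⟩ := hv
        exact ⟨j, fun z _ => hlow j z⟩
      · refine ⟨i₀, fun z hz => ?_⟩
        rcases Finset.mem_insert.1 hz with rfl | hz
        · exact hmax v hv
        · rw [hS, Finset.mem_image] at hz
          obtain ⟨j, hj, rfl⟩ := hz
          exact hhigh i₀ j (by simpa using (Finset.mem_erase.1 hj).1.symm) v hv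

/-- In a set with as many elements as there are colours, on which not all colours appear, the
number of elements whose removal leaves all colours but `i₀` is even. -/
theorem even_card_erase_image_eq (c : V → I) (i₀ : I) {S : Finset V}
    (hcard : S.card = Fintype.card I) (hS : S.image c ≠ Finset.univ) :
    Even (S.filter fun x => (S.erase x).image c = Finset.univ.erase i₀).card := by
  by_cases hemp : (S.filter fun x => (S.erase x).image c = Finset.univ.erase i₀) = ∅
  · simp [hemp]
  obtain ⟨x, hx⟩ := Finset.nonempty_iff_ne_empty.2 hemp
  obtain ⟨hxS, hx⟩ := Finset.mem_filter.1 hx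
  have hinj : ∀ w ∈ S, (S.erase w).image c = Finset.univ.erase i₀ →
      Set.InjOn c (S.erase w : Finset V) := by
    intro w hw h
    rw [← Finset.card_image_iff, h, Finset.card_erase_of_mem hw,
      Finset.card_erase_of_mem (Finset.mem_univ _), Finset.card_univ, hcard]
  have himg : S.image c = insert (c x) (Finset.univ.erase i₀) := by
    rw [← hx, ← Finset.image_insert, Finset.insert_erase hxS]
  have hcx : c x ≠ i₀ := by
    intro h
    apply hS
    rw [himg, h, Finset.insert_erase (Finset.mem_univ _)]
  have himg' : S.image c = Finset.univ.erase i₀ := by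
    rw [himg, Finset.insert_eq_of_mem (by simpa using hcx)]
  -- Exactly one colour is repeated, and its two carriers `x`, `x'` are the removable elements.
  obtain ⟨x', hx'S, hcx'⟩ : ∃ x' ∈ S.erase x, c x' = c x := by
    rw [← Finset.mem_image, hx]
    simpa using hcx
  obtain ⟨hne, hx'S⟩ := Finset.mem_erase.1 hx'S
  have hfilter : (S.filter fun x => (S.erase x).image c = Finset.univ.erase i₀) = {x, x'} := by
    ext w
    simp only [Finset.mem_filter, Finset.mem_insert, Finset.mem_singleton]
    constructor
    · rintro ⟨hw, h⟩
      by_contra! hcon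
      exact hne (hinj w hw h (by simp [hx'S, hcon.2.symm]) (by simp [hxS, hcon.1.symm]) hcx')
    · rintro (rfl | rfl)
      · exact ⟨hxS, hx⟩
      · refine ⟨hx'S, Finset.Subset.antisymm ?_ fun j hj => ?_⟩
        · rw [← himg']
          exact Finset.image_subset_image (Finset.erase_subset _ _)
        · rw [← hx, Finset.mem_image] at hj
          obtain ⟨z, hz, rfl⟩ := hj
          obtain ⟨hzx, hzS⟩ := Finset.mem_erase.1 hz
          rw [Finset.mem_image]
          by_cases hzw : z = w
          · exact ⟨x, by simp [hxS, hne.symm], by rw [hzw, hcx']⟩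
          · exact ⟨z, by simp [hzS, hzw], rfl⟩
  rw [hfilter, Finset.card_pair hne.symm]
  exact even_two

/-- **Scarf's lemma**: for every colouring which is the identity on slack elements there is a
dominant set on which every colour appears exactly once. -/
theorem exists_dominant_colorful [Nonempty I] [Finite V] {r : I → V → α}
    (hr : ∀ i, Function.Injective (r i))
    {e : I → V} (hlow : ∀ i v, r i (e i) ≤ r i v)
    (hhigh : ∀ i j, i ≠ j → ∀ v, v ∉ Set.range e → r i v ≤ r i (e j))
    {t : V} (ht : t ∉ Set.range e) {c : V → I} (hc : ∀ i, c (e i) = i) :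
    ∃ S : Finset V, IsDominant r S ∧ S.card = Fintype.card I ∧ S.image c = Finset.univ := by
  classical
  have := Fintype.ofFinite V
  by_contra! hcon
  obtain ⟨i₀⟩ := ‹Nonempty I›
  -- Incident door-room pairs are counted twice. Without a colourful room the count by rooms is
  -- even; by doors it is odd, as only the slack door `S₀` has an odd number of rooms.
  let doors : Finset (Finset V) :=
    Finset.univ.filter fun S => S.card + 1 = Fintype.card I ∧ S.image c = Finset.univ.erase i₀
  let rooms : Finset (Finset V) :=
    Finset.univ.filter fun S => IsDominant r S ∧ S.card = Fintype.card I
  have hcount : ∑ S ∈ doors, (Finset.univ.filter fun x => x ∉ S ∧ IsDominant r (insert x S)).card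
      = ∑ S ∈ rooms, (S.filter fun x => (S.erase x).image c = Finset.univ.erase i₀).card := by
    rw [← Finset.card_sigma, ← Finset.card_sigma]
    refine Finset.card_bij' (fun p _ => ⟨insert p.2 p.1, p.2⟩) (fun p _ => ⟨p.1.erase p.2, p.2⟩)
      ?_ ?_ ?_ ?_
    · rintro ⟨S, x⟩ h
      simp only [doors, rooms, Finset.mem_sigma, Finset.mem_filter, Finset.mem_univ,
        true_and] at h ⊢
      obtain ⟨⟨h1, h2⟩, h3, h4⟩ := h
      exact ⟨⟨h4, by rw [Finset.card_insert_of_notMem h3, h1]⟩, Finset.mem_insert_self _ _,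
        by rw [Finset.erase_insert h3, h2]⟩
    · rintro ⟨S, x⟩ h
      simp only [doors, rooms, Finset.mem_sigma, Finset.mem_filter, Finset.mem_univ,
        true_and] at h ⊢
      obtain ⟨⟨h1, h2⟩, h3, h4⟩ := h
      exact ⟨⟨by rw [Finset.card_erase_add_one h3, h2], h4⟩, Finset.notMem_erase _ _,
        by rwa [Finset.insert_erase h3]⟩
    · rintro ⟨S, x⟩ h
      simp only [doors, Finset.mem_sigma, Finset.mem_filter, Finset.mem_univ, true_and] at h
      simp [Finset.erase_insert h.2.1]
    · rintro ⟨S, x⟩ h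
      simp only [rooms, Finset.mem_sigma, Finset.mem_filter, Finset.mem_univ, true_and] at h
      simp [Finset.insert_erase h.2.1]
  have heven : Even (∑ S ∈ rooms,
      (S.filter fun x => (S.erase x).image c = Finset.univ.erase i₀).card) := by
    refine Finset.even_sum _ fun S hS => ?_
    obtain ⟨-, h1, h2⟩ := Finset.mem_filter.1 hS
    exact even_card_erase_image_eq c i₀ h2 (hcon S h1 h2)
  have he : Function.Injective e := fun i j h => by rw [← hc i, h, hc]
  let S₀ : Finset V := (Finset.univ.erase i₀).image e
  have hS₀ : S₀ ∈ doors := by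
    simp only [doors, Finset.mem_filter, Finset.mem_univ, true_and]
    constructor
    · rw [Finset.card_image_of_injective _ he, Finset.card_erase_add_one (Finset.mem_univ _),
        Finset.card_univ]
    · rw [Finset.image_image, show c ∘ e = id from funext hc, Finset.image_id]
  rw [← hcount, ← Finset.add_sum_erase _ _ hS₀,
    card_dominant_insert_slack hr hlow hhigh ht i₀ rfl] at heven
  have heven' : Even (∑ S ∈ doors.erase S₀,
      (Finset.univ.filter fun x => x ∉ S ∧ IsDominant r (insert x S)).card) := by
    refine Finset.even_sum _ fun S hS => ?_
    obtain ⟨hne, hS⟩ := Finset.mem_erase.1 hS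
    obtain ⟨-, h1, h2⟩ := Finset.mem_filter.1 hS
    by_cases hslack : ∀ x ∈ S, x ∈ Set.range e
    · exfalso
      apply hne
      ext v
      simp only [S₀, Finset.mem_image]
      rw [← h2]
      constructor
      · intro hv
        obtain ⟨j, rfl⟩ := hslack v hv
        exact ⟨j, Finset.mem_image.2 ⟨_, hv, hc j⟩, rfl⟩
      · rintro ⟨j, hj, rfl⟩
        obtain ⟨w, hw, rfl⟩ := Finset.mem_image.1 hj
        obtain ⟨k, rfl⟩ := hslack w hw
        rwa [hc]
    · push Not at hslack
      obtain ⟨x, hx, hxe⟩ := hslack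
      exact even_card_dominant_insert hr hhigh h1 hx hxe
  rw [Nat.even_add] at heven
  exact absurd (heven.2 heven') (by decide)

end Scarf

/-! ### From Scarf's lemma to Brouwer's theorem -/

/-- A combinatorial form of Brouwer's fixed point theorem on the grid of natural vectors with
coordinate sum `N`. -/
theorem exists_grid_point_near_colors {I : Type*} [Fintype I] [Nonempty I] (N : ℕ)
    (c : (I → ℕ) → I) :
    ∃ t : I → ℕ, ∑ i, t i = N ∧ ∀ i, t i < Fintype.card I ∨
      ∃ s : I → ℕ, ∑ j, s j = N ∧ c s = i ∧
        ∀ j, s j < t j + Fintype.card I ∧ t j < s j + Fintype.card I := by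
  classical
  let T := {t : I → ℕ // t ∈ Finset.piAntidiag Finset.univ N}
  have : Fintype T := inferInstanceAs (Fintype (Finset.piAntidiag Finset.univ N : Finset (I → ℕ)))
  have hT : ∀ t : T, ∑ i, t.1 i = N := fun t => (Finset.mem_piAntidiag.1 t.2).1
  have mkT : ∀ t : I → ℕ, ∑ i, t i = N → ∃ s : T, s.1 = t := fun t ht =>
    ⟨⟨t, Finset.mem_piAntidiag.2 ⟨ht, fun i _ => Finset.mem_univ i⟩⟩, rfl⟩
  -- The shift by 1 keeps slack `i` strictly lowest in ranking `i` even against zero coordinates; `N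
  -- + 2` exceeds every shifted coordinate.
  let h : I → T ⊕ I → ℕ := fun i v =>
    Sum.elim (fun t => t.1 i + 1) (fun j => if i = j then 0 else N + 2) v
  -- The enumeration only breaks ties, making the rankings injective.
  let r : I → T ⊕ I → ℕ ×ₗ Fin (Fintype.card (T ⊕ I)) := fun i v =>
    toLex (h i v, Fintype.equivFin _ v)
  have hr : ∀ i, Function.Injective (r i) := by
    intro i v w hvw
    have := congrArg (fun p => (ofLex p).2) hvw
    exact (Fintype.equivFin _).injective this
  have hle : ∀ i v w, r i v ≤ r i w → h i v ≤ h i w := by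
    intro i v w hvw
    rcases Prod.Lex.toLex_le_toLex.1 hvw with h1 | h1
    exacts [h1.le, h1.1.le]
  have hlt : ∀ i v w, h i v < h i w → r i v ≤ r i w := fun i v w hvw =>
    Prod.Lex.toLex_le_toLex.2 (Or.inl hvw)
  have hbound : ∀ (t : T) i, t.1 i ≤ N := fun t i =>
    (Finset.single_le_sum (f := t.1) (fun _ _ => Nat.zero_le _) (Finset.mem_univ i)).trans_eq (hT t)
  have hrange : ∀ v : T ⊕ I, v ∉ Set.range Sum.inr → ∃ t, v = Sum.inl t := by
    rintro (t | j) hv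
    exacts [⟨t, rfl⟩, absurd ⟨j, rfl⟩ hv]
  obtain ⟨t₀, -⟩ := mkT (Pi.single (Classical.arbitrary I) N) (by simp)
  obtain ⟨S, hdom, -, himg⟩ := exists_dominant_colorful (r := r) hr (e := Sum.inr)
    (t := Sum.inl t₀) (c := Sum.elim (fun t => c t.1) id) (by
      rintro i (t | j)
      · exact hlt _ _ _ (by simp [h])
      · by_cases hij : i = j
        · rw [hij]
        · exact hlt _ _ _ (by simp [h, hij])) (by
      rintro i j hij v hv
      obtain ⟨t, rfl⟩ := hrange v hv
      refine hlt _ _ _ ?_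
      have := hbound t i
      simp only [h, Sum.elim_inl, Sum.elim_inr, if_neg hij]
      omega) (by simp) (fun i => rfl)
  have hcol : ∀ i, ∃ v ∈ S, Sum.elim (fun t : T => c t.1) id v = i := fun i => by
    rw [← Finset.mem_image, himg]
    exact Finset.mem_univ i
  have hdomT : ∀ y : T, ∃ i, Sum.inr i ∉ S ∧ ∀ s, Sum.inl s ∈ S → y.1 i ≤ s.1 i := by
    intro y
    obtain ⟨i, hi⟩ := hdom (Sum.inl y)
    refine ⟨i, fun hiS => ?_, fun s hs => ?_⟩
    · simpa [h] using hle _ _ _ (hi _ hiS)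
    · simpa [h] using hle _ _ _ (hi _ hs)
  have hpt : ∀ i, Sum.inr i ∉ S → ∃ s : T, Sum.inl s ∈ S ∧ c s.1 = i := by
    intro i hi
    obtain ⟨v, hv, hvi⟩ := hcol i
    rcases v with s | j
    · exact ⟨s, hv, hvi⟩
    · exact absurd ((show j = i from hvi) ▸ hv) hi
  have hmin : ∀ i, ∃ m : ℕ, (∀ s, Sum.inl s ∈ S → m ≤ s.1 i) ∧
      (Sum.inr i ∈ S → m = 0) ∧ (Sum.inr i ∉ S → ∃ s, Sum.inl s ∈ S ∧ s.1 i = m) := by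
    intro i
    by_cases hi : Sum.inr i ∈ S
    · exact ⟨0, fun _ _ => Nat.zero_le _, fun _ => rfl, fun h => absurd hi h⟩
    · obtain ⟨s, hs, -⟩ := hpt i hi
      obtain ⟨s', hs', hmin⟩ := Set.exists_min_image {s : T | Sum.inl s ∈ S} (fun s => s.1 i)
        (Set.toFinite _) ⟨s, hs⟩
      exact ⟨s'.1 i, hmin, fun h => absurd h hi, fun _ => ⟨s', hs', rfl⟩⟩
  choose m hm hm0 hms using hmin
  -- Otherwise some grid point exceeds `m` in every coordinate, against dominance. Hence all grid
  -- points of `S` lie in a box of side less than `Fintype.card I` above `m`.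
  have hN : N < ∑ i, (m i + 1) := by
    by_contra! hcon
    obtain ⟨y, hy⟩ := mkT (fun i => m i + 1 +
      (Pi.single (Classical.arbitrary I) (N - ∑ i, (m i + 1)) : I → ℕ) i) (by
        rw [Finset.sum_add_distrib, Finset.sum_pi_single' (Classical.arbitrary I),
          if_pos (Finset.mem_univ _), Nat.add_sub_cancel' hcon])
    obtain ⟨i, hi, his⟩ := hdomT y
    obtain ⟨s, hs, hsm⟩ := hms i hi
    have hys := his s hs
    have hyi := congrFun hy i
    omega
  have hub : ∀ s, Sum.inl s ∈ S → ∀ j, s.1 j < m j + Fintype.card I := by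
    intro s hs j
    have h1 : ∑ i, (s.1 i - m i) + ∑ i, m i = N := by
      rw [← Finset.sum_add_distrib]
      exact (Finset.sum_congr rfl fun i _ => Nat.sub_add_cancel (hm i s hs)).trans (hT s)
    have h2 : s.1 j - m j ≤ ∑ i, (s.1 i - m i) :=
      Finset.single_le_sum (f := fun i => s.1 i - m i) (fun _ _ => Nat.zero_le _)
        (Finset.mem_univ j)
    rw [Finset.sum_add_distrib] at hN
    simp only [Finset.sum_const, Finset.card_univ, smul_eq_mul, mul_one] at hN
    omega
  obtain ⟨i₁, hi₁, -⟩ := hdomT t₀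
  obtain ⟨t, htS, -⟩ := hpt i₁ hi₁
  refine ⟨t.1, hT t, fun i => ?_⟩
  by_cases hi : Sum.inr i ∈ S
  · left
    have := hub t htS i
    rwa [hm0 i hi, zero_add] at this
  · right
    obtain ⟨s, hs, hcs⟩ := hpt i hi
    refine ⟨s.1, hT s, hcs, fun j => ?_⟩
    have h1 := hub t htS j
    have h2 := hub s hs j
    have h3 := hm j t htS
    have h4 := hm j s hs
    omega

/-- **Brouwer's fixed point theorem** on the standard simplex. -/
theorem exists_fixedPoint_stdSimplex {I : Type*} [Fintype I] [Nonempty I]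
    (f : stdSimplex ℝ I → stdSimplex ℝ I) (hf : Continuous f) : ∃ x, f x = x := by
  have happrox : ∀ ε > 0, ∃ x, ∀ i, x i ≤ f x i + ε := by
    intro ε hε
    obtain ⟨δ, hδ, hfδ⟩ := Metric.uniformContinuous_iff.1
      (CompactSpace.uniformContinuous_of_continuous hf) (ε / 2) (half_pos hε)
    obtain ⟨N, hN⟩ := exists_nat_gt ((Fintype.card I : ℝ) / min δ (ε / 2))
    have hδ' : 0 < min δ (ε / 2) := lt_min hδ (half_pos hε)
    have hN0 : (0 : ℝ) < N := lt_of_le_of_lt (by positivity) hN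
    have hcard : (Fintype.card I : ℝ) / N < min δ (ε / 2) := by
      rw [div_lt_iff₀ hδ'] at hN
      rwa [div_lt_iff₀ hN0, mul_comm]
    let p : ∀ t : I → ℕ, ∑ i, t i = N → stdSimplex ℝ I := fun t ht =>
      ⟨fun i => t i / N, fun i => by positivity, by
        rw [← Finset.sum_div, ← Nat.cast_sum, ht, div_self hN0.ne']⟩
    have hp : ∀ t ht i, p t ht i = t i / N := fun _ _ _ => rfl
    -- The colour is a coordinate that `f` does not decrease; off the grid it is arbitrary.
    have hc : ∀ t : I → ℕ, ∃ i, ∀ ht, p t ht i ≤ f (p t ht) i := by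
      intro t
      by_cases ht : ∑ i, t i = N
      · obtain ⟨i, -, hi⟩ := Finset.exists_le_of_sum_le (s := (Finset.univ : Finset I))
          Finset.univ_nonempty (f := fun i => p t ht i) (g := fun i => f (p t ht) i)
          (by rw [stdSimplex.sum_eq_one, stdSimplex.sum_eq_one])
        exact ⟨i, fun _ => hi⟩
      · exact ⟨Classical.arbitrary I, fun h => absurd h ht⟩
    choose c hc using hc
    obtain ⟨t, ht, hts⟩ := exists_grid_point_near_colors N c
    refine ⟨p t ht, fun i => ?_⟩
    rcases hts i with hti | ⟨s, hs, rfl, hst⟩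
    · have h1 : p t ht i ≤ Fintype.card I / N := by
        rw [hp t ht]
        gcongr
      have h2 := stdSimplex.zero_le (f (p t ht)) i
      have h3 := min_le_right δ (ε / 2)
      linarith
    · have hdist : dist (p s hs) (p t ht) < min δ (ε / 2) := by
        rw [Subtype.dist_eq, dist_pi_lt_iff hδ']
        intro j
        refine lt_of_le_of_lt ?_ hcard
        obtain ⟨h1, h2⟩ := hst j
        have h1' : (s j : ℝ) < t j + Fintype.card I := by exact_mod_cast h1
        have h2' : (t j : ℝ) < s j + Fintype.card I := by exact_mod_cast h2
        change |(s j : ℝ) / N - t j / N| ≤ _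
        rw [← sub_div, abs_div, abs_of_pos hN0]
        gcongr
        rw [abs_le]
        constructor <;> linarith
      have h1 : |p s hs (c s) - p t ht (c s)| ≤ dist (p s hs) (p t ht) :=
        dist_le_pi_dist (p s hs).1 (p t ht).1 (c s)
      have h2 : |f (p s hs) (c s) - f (p t ht) (c s)| ≤ dist (f (p s hs)) (f (p t ht)) :=
        dist_le_pi_dist (f (p s hs)).1 (f (p t ht)).1 (c s)
      have h3 := hfδ (hdist.trans_le (min_le_left _ _))
      have h4 := hdist.trans_le (min_le_right _ _)
      have h5 := hc s hs
      have h6 := neg_abs_le (p s hs (c s) - p t ht (c s))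
      have h7 := le_abs_self (f (p s hs) (c s) - f (p t ht) (c s))
      linarith
  have hcoord : ∀ i, Continuous fun x : stdSimplex ℝ I => x i := fun i =>
    (continuous_apply i).comp continuous_subtype_val
  -- This total decrease attains its minimum, which is zero by `happrox`; as coordinates sum to 1 on
  -- both sides, no decrease means equality.
  have hcont : Continuous fun x => ∑ i, max (x i - f x i) 0 :=
    continuous_finsetSum _ fun i _ =>
      ((hcoord i).sub ((hcoord i).comp hf)).max continuous_const
  obtain ⟨x, -, hx⟩ := isCompact_univ.exists_isMinOn Set.univ_nonempty hcont.continuousOn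
  have hle : ∑ i, max (x i - f x i) 0 ≤ 0 := by
    refine le_of_forall_pos_le_add fun ε hε => ?_
    have hn : (0 : ℝ) < Fintype.card I := by exact_mod_cast Fintype.card_pos
    obtain ⟨y, hy⟩ := happrox (ε / Fintype.card I) (div_pos hε hn)
    calc ∑ i, max (x i - f x i) 0 ≤ ∑ i, max (y i - f y i) 0 := hx (Set.mem_univ y)
      _ ≤ ∑ _i : I, ε / Fintype.card I := Finset.sum_le_sum fun i _ =>
          max_le (by linarith [hy i]) (div_pos hε hn).le
      _ = 0 + ε := by
          rw [Finset.sum_const, Finset.card_univ, nsmul_eq_mul, mul_div_cancel₀ _ hn.ne', zero_add]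
  have hall : ∀ i ∈ Finset.univ, x i ≤ f x i := by
    intro i hi
    have h1 := Finset.single_le_sum (f := fun i => max (x i - f x i) 0)
      (fun _ _ => le_max_right _ _) hi
    have h2 := le_max_left (x i - f x i) 0
    linarith
  refine ⟨x, stdSimplex.ext (funext fun i => ?_)⟩
  exact ((Finset.sum_eq_sum_iff_of_le hall).1
    (by rw [stdSimplex.sum_eq_one, stdSimplex.sum_eq_one]) i (Finset.mem_univ i)).symm

/-! ### The KKM lemma -/

/-- The **Knaster–Kuratowski–Mazurkiewicz lemma** for finite families of closed sets. -/
theorem exists_mem_forall_of_convexHull_subset {ι X : Type*} [Finite ι] [Nonempty ι]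
    [AddCommGroup X] [Module ℝ X] [TopologicalSpace X] [ContinuousAdd X] [ContinuousSMul ℝ X]
    (x : ι → X) (G : ι → Set X) (hG : ∀ i, IsClosed (G i))
    (hKKM : ∀ J : Set ι, convexHull ℝ (x '' J) ⊆ ⋃ i ∈ J, G i) :
    ∃ z, ∀ i, z ∈ G i := by
  classical
  have := Fintype.ofFinite ι
  by_contra! hcon
  let φ : stdSimplex ℝ ι → X := fun w => ∑ i, w i • x i
  have hcoord : ∀ i, Continuous fun w : stdSimplex ℝ ι => w i := fun i =>
    (continuous_apply i).comp continuous_subtype_val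
  have hφ : Continuous φ :=
    continuous_finsetSum _ fun i _ => (hcoord i).smul continuous_const
  have hclosed : ∀ i, IsClosed (φ ⁻¹' G i) := fun i => (hG i).preimage hφ
  have hsupp : ∀ (w : stdSimplex ℝ ι) (J : Set ι), (∀ i, i ∉ J → w i = 0) →
      ∃ i ∈ J, w ∈ φ ⁻¹' G i := by
    intro w J hw
    have hmem : φ w ∈ convexHull ℝ (x '' J) := by
      have h1 : ∑ i with i ∈ J, w i = 1 := by
        rw [← stdSimplex.sum_eq_one w]
        exact Finset.sum_subset (Finset.filter_subset _ _) fun i _ hi => hw i (by simpa using hi)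
      have h2 : ∑ i with i ∈ J, w i • x i = φ w :=
        Finset.sum_subset (Finset.filter_subset _ _) fun i _ hi => by
          rw [hw i (by simpa using hi), zero_smul]
      rw [← h2]
      exact (convex_convexHull ℝ _).sum_mem (fun i _ => stdSimplex.zero_le w i) h1
        fun i hi => subset_convexHull ℝ _ ⟨i, by simpa using hi, rfl⟩
    simpa using hKKM J hmem
  -- Needed because `Metric.infDist` to the empty set is 0.
  have hne : ∀ i, (φ ⁻¹' G i).Nonempty := by
    intro i
    obtain ⟨j, rfl, hj⟩ := hsupp (stdSimplex.vertex i) {i} (by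
      intro j hj
      rw [Set.mem_singleton_iff] at hj
      exact Pi.single_eq_of_ne hj _)
    exact ⟨_, hj⟩
  let d : ι → stdSimplex ℝ ι → ℝ := fun i w => Metric.infDist w (φ ⁻¹' G i)
  have hd0 : ∀ i w, 0 ≤ d i w := fun i w => Metric.infDist_nonneg
  have hdpos : ∀ i w, w ∉ φ ⁻¹' G i → 0 < d i w := fun i w h =>
    ((hclosed i).notMem_iff_infDist_pos (hne i)).1 h
  have hdc : ∀ i, Continuous (d i) := fun i => Metric.continuous_infDist_pt _
  have hsum : ∀ w, 0 < ∑ i, d i w := by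
    intro w
    obtain ⟨i, hi⟩ := hcon (φ w)
    exact Finset.sum_pos' (fun i _ => hd0 i w) ⟨i, Finset.mem_univ i, hdpos i w hi⟩
  let F : stdSimplex ℝ ι → stdSimplex ℝ ι := fun w =>
    ⟨fun i => d i w / ∑ j, d j w, fun i => div_nonneg (hd0 i w) (hsum w).le, by
      rw [← Finset.sum_div, div_self (hsum w).ne']⟩
  have hF : Continuous F := by
    refine Continuous.subtype_mk (continuous_pi fun i => ?_) _
    exact (hdc i).div (continuous_finsetSum _ fun j _ => hdc j) fun w => (hsum w).ne'
  obtain ⟨w, hw⟩ := exists_fixedPoint_stdSimplex F hF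
  -- A fixed point of `F` is supported where `d i w > 0`, yet the covering puts it in some `φ ⁻¹' G
  -- i` with `i` in that support, where `d i w = 0`.
  obtain ⟨i, hi, hiG⟩ := hsupp w {i | 0 < d i w} (by
    intro i hi
    have h0 : d i w = 0 := le_antisymm (not_lt.1 hi) (hd0 i w)
    rw [← hw]
    change d i w / _ = 0
    rw [h0, zero_div])
  exact (show 0 < d i w from hi).ne' (Metric.infDist_zero_of_mem hiG)

/-! ### Density in polytopes and strict negativity for the cone -/

/-- A self-segment-dense set is dense in every polytope with vertices in it. -/
theorem IsSelfSegmentDense.convexHull_subset_closure {X : Type*} [AddCommGroup X] [Module ℝ X]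
    [TopologicalSpace X] [ContinuousAdd X] [ContinuousSMul ℝ X] {D K : Set X}
    (hD : IsSelfSegmentDense D K) {S : Set X} (hS : S ⊆ D) :
    convexHull ℝ S ⊆ closure (convexHull ℝ S ∩ D) := by
  refine convexHull_min (fun x hx => subset_closure ⟨subset_convexHull ℝ S hx, hS hx⟩) ?_
  intro x hx y hy a b ha hb hab
  -- One closure moves the endpoints into `D`, the other approximates within the resulting segment.
  rw [← closure_closure]
  refine map_mem_closure₂ (f := fun x y => a • x + b • y) (by fun_prop) hx hy ?_
  rintro u ⟨hu, huD⟩ v ⟨hv, hvD⟩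
  refine closure_mono (Set.inter_subset_inter_left _ ?_)
    (hD.segment_dense u huD v hvD ⟨a, b, ha, hb, hab, rfl⟩)
  exact (convex_convexHull ℝ S).segment_subset hu hv

theorem PointedCone.add_mem_diff_zero {Z : Type*} [AddCommGroup Z] [Module ℝ Z]
    {C : PointedCone ℝ Z} (hC : (C : Set Z) ∩ -(C : Set Z) = {0}) {a b : Z}
    (ha : a ∈ C) (ha0 : a ≠ 0) (hb : b ∈ C) : a + b ∈ (C : Set Z) \ {0} := by
  refine ⟨C.add_mem ha hb, fun h => ha0 ?_⟩
  have hab : -a = b := neg_eq_of_add_eq_zero_right h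
  have : a ∈ (C : Set Z) ∩ -(C : Set Z) := ⟨ha, by rw [Set.mem_neg, hab]; exact hb⟩
  rwa [hC] at this

/-- Some weight is positive, and pointedness keeps the other terms from cancelling that nonzero
summand. -/
theorem PointedCone.sum_smul_mem_neg_diff_zero {Z ι : Type*} [Fintype ι] [AddCommGroup Z]
    [Module ℝ Z] {C : PointedCone ℝ Z} (hC : (C : Set Z) ∩ -(C : Set Z) = {0}) {w : ι → ℝ}
    (hw : ∀ i, 0 ≤ w i) (hw1 : ∑ i, w i = 1) {z : ι → Z}
    (hz : ∀ i, z i ∈ -((C : Set Z) \ {0})) : ∑ i, w i • z i ∈ -((C : Set Z) \ {0}) := by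
  classical
  have hsmul : ∀ i, w i • -z i ∈ C := fun i => C.smul_mem (hw i) (hz i).1
  obtain ⟨i, -, hi⟩ : ∃ i ∈ Finset.univ, 0 < w i := by
    by_contra! hcon
    linarith [Finset.sum_nonpos hcon]
  have hne : w i • -z i ≠ 0 := smul_ne_zero hi.ne' (hz i).2
  have h := PointedCone.add_mem_diff_zero hC (hsmul i) hne
    (C.sum_mem (t := Finset.univ.erase i) fun j _ => hsmul j)
  rw [Finset.add_sum_erase _ (fun j => w j • -z j) (Finset.mem_univ i)] at h
  simpa [Set.mem_neg] using h

/-- Strong upper semicontinuity makes the sublevel set of the negative cone a neighbourhood. -/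
theorem StronglyCUpperSemicontinuousAt.exists_nhds {X Z : Type*} [TopologicalSpace X]
    [AddCommGroup Z] {C : Set Z} {K : Set X} {g : X → Z} {x : X}
    (hg : StronglyCUpperSemicontinuousAt C K g x) (hx : g x ∈ -(C \ {0})) :
    ∃ U ∈ 𝓝 x, ∀ u ∈ U ∩ K, g u ∈ -(C \ {0}) := by
  -- The choice `k = -g x` turns `g x + k - (C \ {0})` into `-(C \ {0})`.
  obtain ⟨U, hU, h⟩ := hg (-g x) hx
  refine ⟨U, hU, fun u hu => ?_⟩
  have := h u hu
  rw [add_neg_cancel] at this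
  obtain ⟨a, ha, b, hb, hab⟩ := this
  rw [Set.mem_singleton_iff] at ha
  simp only [ha, zero_sub] at hab
  rw [← hab]
  simpa using hb

/-- The sets `{x | f x y ∉ -(C \ {0})}` cover `D ∩ conv S` when `y` runs through `S ⊆ D`. -/
theorem exists_notMem_neg_of_mem_convexHull {X Z : Type*} [AddCommGroup X] [Module ℝ X]
    [AddCommGroup Z] [Module ℝ Z] {C : PointedCone ℝ Z}
    (hC : (C : Set Z) ∩ -(C : Set Z) = {0}) {D S : Set X} (hS : S ⊆ D) {g : X → Z}
    (hg : CConvexOn (C : Set Z) D g) {z : X} (hz : z ∈ D) (hgz : g z ∉ -((C : Set Z) \ {0}))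
    (hzS : z ∈ convexHull ℝ S) : ∃ y ∈ S, g y ∉ -((C : Set Z) \ {0}) := by
  by_contra! hcon
  obtain ⟨ι, _, w, y, hw, hw1, hy, rfl⟩ := mem_convexHull_iff_exists_fintype.1 hzS
  have e := Fintype.equivFin ι
  have hsum : ∑ i, (w ∘ e.symm) i • (y ∘ e.symm) i = ∑ i, w i • y i :=
    e.symm.sum_comp fun i => w i • y i
  have hw1' : ∑ i, (w ∘ e.symm) i = 1 := (e.symm.sum_comp w).trans hw1
  have h1 := hg _ (y ∘ e.symm) (w ∘ e.symm) (fun i => hS (hy _)) (fun i => hw _) hw1'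
    (by rwa [hsum])
  rw [hsum] at h1
  have h2 := PointedCone.sum_smul_mem_neg_diff_zero hC (fun i => hw (e.symm i)) hw1'
    (z := fun i => g ((y ∘ e.symm) i)) fun i => hcon _ (hy (e.symm i))
  have h3 := PointedCone.add_mem_diff_zero hC h2.1 h2.2 h1
  simp only [Function.comp_apply, neg_add_eq_sub, sub_sub_cancel_left] at h3
  exact hgz h3

/-! ### The existence theorem -/

theorem theoremt2 {X Z : Type*}
    [AddCommGroup X] [Module ℝ X] [TopologicalSpace X] [IsTopologicalAddGroup X]
    [ContinuousSMul ℝ X] [LocallyConvexSpace ℝ X] [T2Space X]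
    [AddCommGroup Z] [Module ℝ Z] [TopologicalSpace Z] [IsTopologicalAddGroup Z]
    [ContinuousSMul ℝ Z] [LocallyConvexSpace ℝ Z] [T2Space Z]
    (C : PointedCone ℝ Z) (hC : (C : Set Z) ∩ -(C : Set Z) = {0})
    (K : Set X) (hK_ne : K.Nonempty) (hK_conv : Convex ℝ K) (hK_comp : IsCompact K)
    (D : Set X) (hD : IsSelfSegmentDense D K)
    (f : X → X → Z)
    (h_i : ∀ y ∈ D, ∀ x ∈ K, StronglyCUpperSemicontinuousAt (C : Set Z) K (fun u => f u y) x)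
    (h_ii : ∀ x ∈ K, ∀ y ∈ K \ D, StronglyCUpperSemicontinuousAt (C : Set Z) K (fun u => f x u) y)
    (h_iii : ∀ x ∈ D, CConvexOn (C : Set Z) D (fun y => f x y))
    (h_iv : ∀ x ∈ D, f x x ∉ -((C : Set Z) \ {0})) :
    ∃ x₀ ∈ K, ∀ y ∈ K, f x₀ y ∉ -((C : Set Z) \ {0}) := by
  have hclosed : ∀ y ∈ D, IsClosed {x ∈ K | f x y ∉ -((C : Set Z) \ {0})} := by
    intro y hy
    refine isClosed_of_closure_subset fun x hx => ?_
    have hxK : x ∈ K := hK_comp.isClosed.closure_subset_iff.2 (fun _ h => h.1) hx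
    refine ⟨hxK, fun hneg => ?_⟩
    obtain ⟨U, hU, h⟩ := (h_i y hy x hxK).exists_nhds hneg
    obtain ⟨u, huU, huK, hu⟩ := mem_closure_iff_nhds.1 hx U hU
    exact hu (h u ⟨huU, huK⟩)
  obtain ⟨x₀, hx₀K, hx₀⟩ := hK_comp.inter_iInter_nonempty
    (fun y : D => {x ∈ K | f x y ∉ -((C : Set Z) \ {0})}) (fun y => hclosed y y.2) (by
      intro s
      -- The empty family is separate: membership of `z` in `K` is read off from a member of `s`.
      rcases s.eq_empty_or_nonempty with rfl | ⟨y₀, hy₀⟩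
      · simpa using hK_ne
      have : Nonempty s := ⟨⟨y₀, hy₀⟩⟩
      obtain ⟨z, hz⟩ := exists_mem_forall_of_convexHull_subset (fun y : s => (y.1 : X))
        (fun y => {x ∈ K | f x y.1 ∉ -((C : Set Z) \ {0})}) (fun y => hclosed _ y.1.2) (by
          intro J
          have hJD : (fun y : s => (y.1 : X)) '' J ⊆ D := by
            rintro _ ⟨y, -, rfl⟩
            exact y.1.2
          refine (hD.convexHull_subset_closure hJD).trans (closure_minimal ?_
            ((Set.toFinite J).isClosed_biUnion fun y _ => hclosed _ y.1.2))
          rintro z ⟨hzJ, hzD⟩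
          obtain ⟨_, ⟨y, hyJ, rfl⟩, hy⟩ := exists_notMem_neg_of_mem_convexHull hC hJD
            (h_iii z hzD) hzD (h_iv z hzD) hzJ
          exact Set.mem_biUnion hyJ ⟨hD.subset hzD, hy⟩)
      exact ⟨z, (hz ⟨y₀, hy₀⟩).1, Set.mem_iInter₂.2 fun y hy => hz ⟨y, hy⟩⟩)
  have hx₀D : ∀ y ∈ D, f x₀ y ∉ -((C : Set Z) \ {0}) := fun y hy =>
    (Set.mem_iInter.1 hx₀ ⟨y, hy⟩).2
  refine ⟨x₀, hx₀K, fun y hyK hy => ?_⟩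
  by_cases hyD : y ∈ D
  · exact hx₀D y hyD hy
  · obtain ⟨U, hU, h⟩ := (h_ii x₀ hx₀K y ⟨hyK, hyD⟩).exists_nhds hy
    obtain ⟨u, huU, huD⟩ := mem_closure_iff_nhds.1 (hD.dense hyK) U hU
    exact hx₀D u huD (h u ⟨huU, hD.subset huD⟩)
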